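/- Consider the Tower of Hanoi puzzle with $4$ pegs and $n \ge 0$ disks of distinct sizes: one may move only one disk at a time, from the top of one peg to the top of another, and a larger disk may never be placed on a smaller one. Let $H_4(n)$ be the minimum number of moves needed to transfer the tower of all $n$ disks from a given peg to a given other peg. Let $X_4(n)$ be the number of moves of the Frame–Stewart method with $4$ pegs, that is, $X_4(0)=0$ and $$X_4(n)=\min_{0\le m<n}\bigl(2X_4(m)+2^{\,n-m}-1\bigr)\qquad(n\ge 1).$$ Then for every $n\ge 0$, and for every choice of two distinct pegs as initial and final peg, $$H_4(n)=X_4(n)=\sum_{j=1}^{n}2^{f_4(j)-1},$$ where, for $j\ge1$, $f_4(j)-1$ is the largest integer $m\ge 0$ with $j>\frac{m(m+1)}{2}$. In particular the Frame–Stewart solutions for $4$ pegs are optimal. -/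

import Mathlib

namespace Hanoi

/-- An arrangement of `n` disks on `k` pegs in which no disk lies on a smaller one. Disks are
ordered by size (`d < e` means that `d` is smaller than `e`). The disks on a peg then necessarily
lie in decreasing order from bottom to top, so that an arrangement amounts to the assignment to
each disk of the peg on which it lies. -/
abbrev Config (k n : ℕ) : Type := Fin n → Fin k

/-- The arrangement in which the whole tower is on the peg `a`. -/
def tower (k n : ℕ) (a : Fin k) : Config k n := fun _ => a

/-- `IsMove s t`: the arrangement `t` is obtained from `s` by one legal move, that is, by moving
a single disk `d` to a peg `p` other than its own, where `d` is the top disk of its peg (no smaller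
disk is there) and is not put on a smaller disk (no smaller disk is on `p`). -/
def IsMove {k n : ℕ} (s t : Config k n) : Prop :=
  ∃ (d : Fin n) (p : Fin k), p ≠ s d ∧ (∀ e : Fin n, e < d → s e ≠ s d ∧ s e ≠ p) ∧
    t = Function.update s d p

/-- `CanTransfer k n a b l`: there is a sequence of exactly `l` legal moves that takes the tower of
`n` disks from the peg `a` to the peg `b`, with `k` pegs available. -/
def CanTransfer (k n : ℕ) (a b : Fin k) (l : ℕ) : Prop :=
  ∃ c : ℕ → Config k n, c 0 = tower k n a ∧ c l = tower k n b ∧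
    ∀ i : ℕ, i < l → IsMove (c i) (c (i + 1))

/-- The number of moves of the Frame–Stewart method with 4 pegs: to transfer `n ≥ 1` disks, choose
`m < n`, stack the `m` smallest disks on an intermediate peg by the same method with 4 pegs,
transfer the other `n - m` disks with the 3 remaining pegs, in `2 ^ (n - m) - 1` moves, and
transfer the `m` smallest disks on top of them with 4 pegs; `m` is chosen so as to make the total
as small as possible. -/
def frameStewart : ℕ → ℕ
  | 0 => 0
  | n + 1 => (Finset.univ : Finset (Fin (n + 1))).inf' Finset.univ_nonempty
      (fun m => 2 * frameStewart m.val + (2 ^ (n + 1 - m.val) - 1))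
decreasing_by exact m.isLt

/-- `f4 j - 1` is the largest `m` such that `j > m (m + 1) / 2`, for `j ≥ 1`. -/
def f4 (j : ℕ) : ℕ := Nat.findGreatest (fun m => m * (m + 1) / 2 < j) j + 1

theorem isGreatest_f4 (j : ℕ) (hj : 1 ≤ j) :
    IsGreatest {m : ℕ | m * (m + 1) / 2 < j} (f4 j - 1) := by
  refine ⟨?_, ?_⟩
  · have h := Nat.findGreatest_spec (P := fun m => m * (m + 1) / 2 < j) (m := 0) (n := j)
      (Nat.zero_le _) (by simp; omega)
    simpa [f4] using h
  · intro m hm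
    have hm' : m * (m + 1) / 2 < j := hm
    have hmj : m ≤ j := by
      rcases Nat.eq_zero_or_pos m with h0 | h0
      · omega
      · have h1 : m * 2 ≤ m * (m + 1) := Nat.mul_le_mul_left m (by omega)
        omega
    simpa [f4] using Nat.le_findGreatest hmj hm'

end Hanoi

/-! The upper bound is the Frame–Stewart strategy, carried out in `reaches_fill` and compared with
the sum in `frameStewart_le_sum`.

The lower bound follows Bousch. An induction on tower transfers alone fails, because the small disks
may be arranged arbitrarily in between. Instead, `Clears` bounds the cost of emptying two pegs from
an arbitrary start, by the weights `psi L` of what lay on one of them. Whenever a disk moves, its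
source and target pegs are free of smaller disks, so the bound applies before a move of the largest
disk and, in reversed time, after one. For a tower this gives twice a weight plus one, which is the
required sum at a suitable level.

`Clears` is proved by induction on the number of disks (`clears_succ`). Let the largest disk `N`
start on `a`, and consider its last departure from `a`: the smaller disks then occupy only two pegs.
If the contents of both must be accounted for, one of the two weights is large enough. The
obstruction is a peg `q` that `N` never visits. The disks from `a` that also avoid `q` have only
three pegs and cost exponentially many moves; the largest disk `T` from `a` that visits `q` replaces
`N` as pivot for the disks below it. -/

namespace Hanoi

/-! ### The triangular root and the weights `psi` -/

/-- The largest `m` such that `m * (m + 1) / 2 ≤ n`. -/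
def triRoot (n : ℕ) : ℕ := f4 (n + 1) - 1

/-- The `m`-th triangular number. -/
def tri (m : ℕ) : ℕ := m * (m + 1) / 2

theorem tri_zero : tri 0 = 0 := rfl

theorem tri_succ (m : ℕ) : tri (m + 1) = tri m + (m + 1) := by
  unfold tri
  have : (m + 1) * (m + 1 + 1) = m * (m + 1) + (m + 1) * 2 := by ring
  omega

theorem tri_mono : Monotone tri :=
  monotone_nat_of_le_succ fun m => by rw [tri_succ]; omega

theorem le_triRoot {m n : ℕ} : m ≤ triRoot n ↔ tri m ≤ n := by
  have h := isGreatest_f4 (n + 1) (by omega)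
  constructor
  · intro hm
    have h1 : tri (f4 (n + 1) - 1) < n + 1 := h.1
    have h2 := tri_mono hm
    unfold triRoot at h2
    omega
  · intro hm
    exact h.2 (show tri m < n + 1 by omega)

theorem triRoot_lt {m n : ℕ} : triRoot n < m ↔ n < tri m := by
  rw [← not_le, le_triRoot, not_le]

theorem triRoot_tri_add {p r : ℕ} (h : r ≤ p) : triRoot (tri p + r) = p := by
  apply le_antisymm
  · exact Nat.lt_succ_iff.1 (triRoot_lt.2 (by rw [Nat.succ_eq_add_one, tri_succ]; omega))
  · exact le_triRoot.2 (by omega)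

theorem exists_eq_tri_add (n : ℕ) : ∃ p r, r ≤ p ∧ n = tri p + r := by
  have h1 : tri (triRoot n) ≤ n := le_triRoot.1 le_rfl
  have h2 : n < tri (triRoot n + 1) := triRoot_lt.1 (Nat.lt_succ_self _)
  rw [tri_succ] at h2
  exact ⟨triRoot n, n - tri (triRoot n), by omega, by omega⟩

/-- The value `p` is taken on the block of `p + 1` integers starting at `tri p`. The case `r = p +
1` is allowed so that one block hands over to the next. -/
theorem sum_two_pow_triRoot (p r : ℕ) (h : r ≤ p + 1) :
    ∑ k ∈ Finset.range (tri p + r), (2 : ℤ) ^ triRoot k = (p - 1 + r) * 2 ^ p + 1 := by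
  have step : ∀ p : ℕ, ∑ k ∈ Finset.range (tri p), (2 : ℤ) ^ triRoot k = (p - 1) * 2 ^ p + 1 →
      ∀ r ≤ p + 1, ∑ k ∈ Finset.range (tri p + r), (2 : ℤ) ^ triRoot k =
        (p - 1 + r) * 2 ^ p + 1 := by
    intro p hp r
    induction r with
    | zero => intro _; simpa using hp
    | succ r ih =>
      intro hr
      rw [← add_assoc, Finset.sum_range_succ, ih (by omega), triRoot_tri_add (by omega)]
      push_cast
      ring
  refine step p ?_ r h
  clear h
  induction p with
  | zero => simp [tri_zero]
  | succ p ih =>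
    rw [tri_succ, step p ih _ le_rfl]
    push_cast
    ring

theorem sum_two_pow_min (l T : ℕ) (h : tri l ≤ T) :
    ∑ k ∈ Finset.range T, (2 : ℤ) ^ min (triRoot k) l =
      (l - 1) * 2 ^ l + 1 + ((T : ℤ) - tri l) * 2 ^ l := by
  induction T, h using Nat.le_induction with
  | base =>
    have h0 := sum_two_pow_triRoot l 0 (by omega)
    simp only [add_zero, Nat.cast_zero] at h0
    rw [sub_self, zero_mul, add_zero, ← h0]
    refine Finset.sum_congr rfl fun k hk => ?_
    rw [min_eq_left (triRoot_lt.2 (Finset.mem_range.1 hk)).le]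
  | succ T h ih =>
    rw [Finset.sum_range_succ, ih, min_eq_right (le_triRoot.2 h)]
    push_cast
    ring

/-- Bousch's weight of a set of disks, at level `L`. -/
def psi (L : ℕ) (E : Finset ℕ) : ℤ :=
  (1 - L) * 2 ^ L - 1 + ∑ n ∈ E, 2 ^ min (triRoot n) L

theorem psi_mono (L : ℕ) {E F : Finset ℕ} (h : E ⊆ F) : psi L E ≤ psi L F := by
  unfold psi
  have := Finset.sum_le_sum_of_subset_of_nonneg (f := fun n => (2 : ℤ) ^ min (triRoot n) L) h
    (fun _ _ _ => by positivity)
  linarith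

/-- Raising the level doubles the terms with root above `L`, so it pays only when there are more
than `L + 1` of them. -/
theorem psi_succ (L : ℕ) (E : Finset ℕ) :
    psi (L + 1) E = psi L E + 2 ^ L * ((E.filter (fun n => L + 1 ≤ triRoot n)).card - (L + 1)) := by
  have h : ∀ n, (2 : ℤ) ^ min (triRoot n) (L + 1) =
      2 ^ min (triRoot n) L + if L + 1 ≤ triRoot n then 2 ^ L else 0 := by
    intro n
    split_ifs with h
    · rw [min_eq_right h, min_eq_right (by omega)]
      ring
    · rw [min_eq_left (by omega), min_eq_left (by omega), add_zero]
  unfold psi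
  rw [Finset.sum_congr rfl (fun n _ => h n), Finset.sum_add_distrib, ← Finset.sum_filter,
    Finset.sum_const, nsmul_eq_mul]
  push_cast
  ring

/-- The level `L` may be lowered until many disks of `E` have a triangular root at least `L`. -/
theorem exists_psi_le (L : ℕ) (E : Finset ℕ) :
    ∃ L', psi L E ≤ psi L' E ∧
      (L' = 0 ∨ L' + 1 ≤ (E.filter (fun n => L' ≤ triRoot n)).card) := by
  induction L with
  | zero => exact ⟨0, le_rfl, Or.inl rfl⟩
  | succ L ih =>
    by_cases h : L + 1 + 1 ≤ (E.filter (fun n => L + 1 ≤ triRoot n)).card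
    · exact ⟨L + 1, le_rfl, Or.inr h⟩
    · obtain ⟨L', h1, h2⟩ := ih
      refine ⟨L', le_trans ?_ h1, h2⟩
      rw [psi_succ]
      have h3 : ((E.filter (fun n => L + 1 ≤ triRoot n)).card : ℤ) - (L + 1) ≤ 0 := by
        have : (E.filter (fun n => L + 1 ≤ triRoot n)).card ≤ L + 1 := by omega
        have : ((E.filter (fun n => L + 1 ≤ triRoot n)).card : ℤ) ≤ (L + 1 : ℕ) := by
          exact_mod_cast this
        push_cast at this
        linarith
      have := mul_nonpos_of_nonneg_of_nonpos (show (0 : ℤ) ≤ 2 ^ L by positivity) h3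
      linarith

theorem psi_le_two_pow_card (L : ℕ) (E : Finset ℕ) : psi L E ≤ 2 ^ E.card - 1 := by
  have h1 : ∑ n ∈ E, (2 : ℤ) ^ min (triRoot n) L ≤ E.card * 2 ^ L := by
    rw [← nsmul_eq_mul]
    exact Finset.sum_le_card_nsmul _ _ _ fun n _ => pow_le_pow_right₀ (by norm_num) (by omega)
  unfold psi
  suffices h : ((1 : ℤ) - L + E.card) * 2 ^ L ≤ 2 ^ E.card by linarith
  rcases le_total L E.card with h | h
  · obtain ⟨d, hd⟩ := Nat.exists_eq_add_of_le h
    rw [hd, pow_add]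
    have h2 : ((d + 1 : ℕ) : ℤ) ≤ ((2 ^ d : ℕ) : ℤ) := by exact_mod_cast Nat.lt_two_pow_self
    push_cast at h2 ⊢
    nlinarith [show (0 : ℤ) < 2 ^ L by positivity]
  · rcases h.eq_or_lt with h | h
    · rw [h]; simp
    · have h2 : ((1 : ℤ) - L + E.card) ≤ 0 := by
        have : ((E.card + 1 : ℕ) : ℤ) ≤ L := by exact_mod_cast h
        push_cast at this
        linarith
      have := mul_nonpos_of_nonpos_of_nonneg h2 (show (0 : ℤ) ≤ 2 ^ L by positivity)
      linarith [show (0 : ℤ) < 2 ^ E.card by positivity]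

/-- The constant in `psi` makes the first `tri l` integers weigh zero together; each later one has
root at least `l` and adds `2 ^ l`. -/
theorem psi_range (l T : ℕ) (h : tri l ≤ T) :
    psi l (Finset.range T) = ((T : ℤ) - tri l) * 2 ^ l := by
  rw [psi, sum_two_pow_min l T h]
  ring

theorem psi_union_le (l : ℕ) (A B : Finset ℕ) :
    psi l (A ∪ B) + ((1 - l) * 2 ^ l - 1) ≤ psi l A + psi l B := by
  unfold psi
  have := Finset.sum_union_inter (s₁ := A) (s₂ := B) (f := fun n => (2 : ℤ) ^ min (triRoot n) l)
  have h2 : (0 : ℤ) ≤ ∑ n ∈ A ∩ B, (2 : ℤ) ^ min (triRoot n) l :=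
    Finset.sum_nonneg fun _ _ => by positivity
  linarith

theorem psi_union_of_disjoint (l : ℕ) {A G : Finset ℕ} (h : Disjoint A G)
    (hG : ∀ g ∈ G, l ≤ triRoot g) : psi l (A ∪ G) = psi l A + G.card * 2 ^ l := by
  unfold psi
  rw [Finset.sum_union h, Finset.sum_congr rfl (fun g hg => by rw [min_eq_right (hG g hg)] :
    ∀ g ∈ G, (2 : ℤ) ^ min (triRoot g) l = 2 ^ l), Finset.sum_const, nsmul_eq_mul]
  ring

theorem psi_add_psi_of_range_subset {l T : ℕ} {A B : Finset ℕ} (h : tri l ≤ T)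
    (hAB : Finset.range T ⊆ A ∪ B) :
    ((T : ℤ) - tri l) * 2 ^ l + ((1 - l) * 2 ^ l - 1) ≤ psi l A + psi l B := by
  have := psi_mono l hAB
  rw [psi_range l T h] at this
  linarith [psi_union_le l A B]

/-- The elements of `E` with root at least `L` lie between `tri L` and `N`, so `N` is large when
there are many of them. Then `A` and `B`, which together cover `range N`, cannot both be light at
level `L - 1`. -/
theorem two_pow_le_of_range_subset {N L : ℕ} {E A B : Finset ℕ} (hE : E ⊆ Finset.range (N + 1))
    (hL : L = 0 ∨ L + 1 ≤ (E.filter (fun n => L ≤ triRoot n)).card)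
    (hAB : Finset.range N ⊆ A ∪ B) {C : ℕ} (hA : ∀ l, psi l A ≤ C) (hB : ∀ l, psi l B ≤ C) :
    (2 : ℤ) ^ L ≤ C + 1 := by
  rcases Nat.eq_zero_or_pos L with h0 | h0
  · rw [h0]; simp
  obtain ⟨l, rfl⟩ : ∃ l, L = l + 1 := ⟨L - 1, by omega⟩
  have h1 : (E.filter (fun n => l + 1 ≤ triRoot n)).card ≤ N + 1 - tri (l + 1) := by
    rw [← Nat.card_Ico]
    refine Finset.card_le_card fun n hn => ?_
    rw [Finset.mem_filter] at hn
    have := Finset.mem_range.1 (hE hn.1)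
    exact Finset.mem_Ico.2 ⟨le_triRoot.1 hn.2, this⟩
  have ht := tri_succ l
  have h2 : tri l + (2 * l + 2) ≤ N := by omega
  have h3 := psi_add_psi_of_range_subset (l := l) (by omega) hAB
  have h4 : (tri l : ℤ) + (2 * l + 2) ≤ N := by exact_mod_cast h2
  have hp : (1 : ℤ) ≤ 2 ^ l := one_le_pow₀ (by norm_num)
  have h5 : (2 * (l : ℤ) + 2) * 2 ^ l ≤ ((N : ℤ) - tri l) * 2 ^ l :=
    mul_le_mul_of_nonneg_right (by linarith) (by positivity)
  have h6 : (0 : ℤ) ≤ l * 2 ^ l := by positivity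
  -- The two weights add up to at least `(l + 3) * 2 ^ l - 1`; the inequality still needed is an
  -- equality at `l = 0`.
  have h8 : (4 : ℤ) * 2 ^ l ≤ (l + 3) * 2 ^ l + 1 := by
    rcases Nat.eq_zero_or_pos l with h | h
    · subst h; norm_num
    · have : (1 : ℤ) ≤ l := by exact_mod_cast h
      nlinarith
  rw [pow_succ]
  linarith [hA l, hB l]

/-- The elements counted lie in `G` or between `tri L` and `T`. Since `G` cannot hold all of them,
that interval is nonempty and the truncated subtraction giving its length is harmless. -/
theorem le_triRoot_of_lt_card {T L : ℕ} {E G : Finset ℕ}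
    (hE : ∀ k ∈ E, T < k → k ∈ G) (hG : G.card ≤ L)
    (hL : L + 1 ≤ (E.filter (fun n => L ≤ triRoot n)).card) :
    tri L + (L + 1) ≤ T + 1 + G.card := by
  have h1 : E.filter (fun n => L ≤ triRoot n) ⊆ Finset.Ico (tri L) (T + 1) ∪ G := by
    intro k hk
    rw [Finset.mem_filter] at hk
    rw [Finset.mem_union, Finset.mem_Ico]
    rcases lt_or_ge T k with h | h
    · exact Or.inr (hE k hk.1 h)
    · exact Or.inl ⟨le_triRoot.1 hk.2, by omega⟩
  have h2 := (Finset.card_le_card h1).trans (Finset.card_union_le _ _)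
  rw [Nat.card_Ico] at h2
  omega

/-- Case where the pivot `T` reaches the fourth peg after the largest disk has left. -/
theorem two_pow_le_of_late_visit {T L : ℕ} {A B G : Finset ℕ} (hL0 : 1 ≤ L)
    (hL : L ≤ triRoot T) (hcard : tri L + L ≤ T + G.card + 1)
    (hAB : Finset.range T ⊆ A ∪ B) (hA : A ⊆ Finset.range T) (hG : ∀ g ∈ G, T < g) {C : ℕ}
    (h1 : ∀ l, psi l B + 2 ^ G.card ≤ C) (h2 : ∀ l, psi l (A ∪ insert T G) ≤ C) :
    (2 : ℤ) ^ L ≤ C + 1 := by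
  obtain ⟨l, rfl⟩ : ∃ l, L = l + 1 := ⟨L - 1, by omega⟩
  have hTG : T ∉ G := fun h => lt_irrefl _ (hG T h)
  have hlT : ∀ g ∈ insert T G, l ≤ triRoot g := by
    intro g hg
    rw [le_triRoot] at hL ⊢
    have := tri_mono (Nat.le_succ l)
    rcases Finset.mem_insert.1 hg with rfl | hg
    · exact this.trans hL
    · exact this.trans (hL.trans (hG g hg).le)
  have hdis : Disjoint A (insert T G) := by
    rw [Finset.disjoint_left]
    intro k hk hk'
    have := Finset.mem_range.1 (hA hk)
    rcases Finset.mem_insert.1 hk' with rfl | hk'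
    · omega
    · have := hG k hk'
      omega
  have h3 := psi_union_of_disjoint l hdis hlT
  rw [Finset.card_insert_of_notMem hTG] at h3
  have ht := tri_succ l
  have h4 := psi_add_psi_of_range_subset (l := l) (by
    have := le_triRoot.1 hL
    omega) hAB
  have h5 : (tri l : ℤ) + (2 * l + 1) ≤ T + G.card := by
    have : tri l + (2 * l + 1) ≤ T + G.card := by omega
    exact_mod_cast this
  have h6 : (2 * (l : ℤ) + 1) * 2 ^ l ≤ ((T : ℤ) + G.card - tri l) * 2 ^ l :=
    mul_le_mul_of_nonneg_right (by linarith) (by positivity)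
  have h7 : (1 : ℤ) ≤ 2 ^ G.card := one_le_pow₀ (by norm_num)
  have h8 : (4 : ℤ) * 2 ^ l ≤ (l + 3) * 2 ^ l + 2 := by
    rcases Nat.eq_zero_or_pos l with h | h
    · subst h; norm_num
    · have : (1 : ℤ) ≤ l := by exact_mod_cast h
      nlinarith [show (0 : ℤ) < 2 ^ l by positivity]
  have h9 := h1 l
  have h10 := h2 l
  push_cast at h3
  rw [pow_succ]
  linarith

/-- Case where the pivot `T` has reached the fourth peg when the largest disk leaves. -/
theorem psi_le_of_early_visit {T L : ℕ} {E A B G : Finset ℕ} (hGL : G.card + 1 ≤ L)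
    (hL : L ≤ triRoot T) (hE : E ⊆ Finset.range T)
    (hAB : Finset.range T ⊆ A ∪ B) (hA : A ⊆ Finset.range T) (hG : ∀ g ∈ G, T < g)
    {C₁ C₂ C₃ : ℤ} (h1 : ∀ l, psi l E ≤ C₁) (h2 : ∀ l, psi l B ≤ C₂)
    (h3 : ∀ l, psi l (A ∪ G) ≤ C₃) :
    psi L E + (G.card + 2) * 2 ^ L ≤ C₁ + C₂ + C₃ + 1 + 2 ^ G.card := by
  have hpsiG : ∀ l ≤ L, psi l (A ∪ G) = psi l A + G.card * 2 ^ l := by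
    intro l hl
    refine psi_union_of_disjoint l ?_ fun g hg => ?_
    · rw [Finset.disjoint_left]
      intro k hk hk'
      have := Finset.mem_range.1 (hA hk)
      have := hG k hk'
      omega
    · rw [le_triRoot] at hL ⊢
      exact (tri_mono hl).trans (hL.trans (hG g hg).le)
  have hLT := le_triRoot.1 hL
  rcases hL.lt_or_eq with hlt | heq
  · have h4 := psi_add_psi_of_range_subset hLT hAB
    have h5 := tri_succ L
    have h6 : tri L + (L + 1) ≤ T := by
      rw [← h5]
      exact le_triRoot.1 hlt
    have h7 : (tri L : ℤ) + (L + 1) ≤ T := by exact_mod_cast h6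
    have h8 : ((L : ℤ) + 1) * 2 ^ L ≤ ((T : ℤ) - tri L) * 2 ^ L :=
      mul_le_mul_of_nonneg_right (by linarith) (by positivity)
    have h9 := h1 L
    have h10 := h2 L
    have h11 := h3 L
    rw [hpsiG L le_rfl] at h11
    have : (0 : ℤ) ≤ 2 ^ G.card := by positivity
    linarith
  -- Here `T` may barely exceed `tri L`, and level `L` gives too little. One level lower, `E` loses
  -- at most `2 ^ l` for each integer from `tri L` to `T - 1`, which the cover `A ∪ B` of the same
  -- integers compensates.
  · obtain ⟨l, rfl⟩ : ∃ l, L = l + 1 := ⟨L - 1, by omega⟩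
    have h4 := psi_add_psi_of_range_subset ((tri_mono (Nat.le_succ l)).trans hLT) hAB
    have h5 : (tri (l + 1) : ℤ) = tri l + (l + 1) := by exact_mod_cast tri_succ l
    have h6 : ((E.filter (fun n => l + 1 ≤ triRoot n)).card : ℤ) ≤ T - tri (l + 1) := by
      rw [← Nat.cast_sub hLT, ← Nat.card_Ico]
      refine Nat.cast_le.2 (Finset.card_le_card fun n hn => ?_)
      rw [Finset.mem_filter] at hn
      exact Finset.mem_Ico.2 ⟨le_triRoot.1 hn.2, Finset.mem_range.1 (hE hn.1)⟩
    have h7 := mul_le_mul_of_nonneg_left h6 (show (0 : ℤ) ≤ 2 ^ l by positivity)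
    rw [psi_succ]
    have h9 := h1 l
    have h10 := h2 l
    have h11 := h3 l
    rw [hpsiG l (Nat.le_succ l)] at h11
    rw [h5] at h7
    -- What remains is `(1 - d) * 2 ^ l ≤ 2 ^ G.card`, whose left side is positive only when `d =
    -- 0`.
    obtain ⟨d, hd⟩ : ∃ d, l = G.card + d := ⟨l - G.card, by omega⟩
    have h12 : ((1 : ℤ) - d) * 2 ^ l ≤ 2 ^ G.card := by
      rcases Nat.eq_zero_or_pos d with h | h
      · rw [h, hd, h]; simp
      · have : (1 : ℤ) ≤ d := by exact_mod_cast h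
        have := mul_nonpos_of_nonpos_of_nonneg (show (1 : ℤ) - d ≤ 0 by linarith)
          (show (0 : ℤ) ≤ 2 ^ l by positivity)
        linarith [show (0 : ℤ) < 2 ^ G.card by positivity]
    have h13 : (l : ℤ) = G.card + d := by exact_mod_cast hd
    have h14 : (d : ℤ) = l - G.card := by linarith
    rw [h14] at h12
    rw [pow_succ]
    linarith

/-! ### Paths -/

/-- A sequence of arrangements of infinitely many disks in which consecutive arrangements are
related by a legal move (or equal). -/
def Legal (c : ℕ → ℕ → Fin 4) : Prop :=
  ∀ i k, c (i + 1) k ≠ c i k → ∀ j < k, c (i + 1) j = c i j ∧ c i j ≠ c i k ∧ c i j ≠ c (i + 1) k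

/-- The number of moves of the disks in `D` between the times `s` and `t`. -/
def cost (c : ℕ → ℕ → Fin 4) (D : Finset ℕ) (s t : ℕ) : ℕ :=
  ∑ i ∈ Finset.Ico s t, (D.filter (fun k => c (i + 1) k ≠ c i k)).card

variable {c : ℕ → ℕ → Fin 4}

theorem cost_add (D : Finset ℕ) {s m t : ℕ} (h1 : s ≤ m) (h2 : m ≤ t) :
    cost c D s m + cost c D m t = cost c D s t :=
  Finset.sum_Ico_consecutive _ h1 h2

theorem cost_mono {D D' : Finset ℕ} (h : D ⊆ D') (s t : ℕ) : cost c D s t ≤ cost c D' s t :=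
  Finset.sum_le_sum fun _ _ => Finset.card_le_card (Finset.filter_subset_filter _ h)

theorem cost_mono_right (D : Finset ℕ) {s m t : ℕ} (h1 : s ≤ m) (h2 : m ≤ t) :
    cost c D s m ≤ cost c D s t := by
  rw [← cost_add D h1 h2]; omega

theorem cost_mono_left (D : Finset ℕ) {s m t : ℕ} (h1 : s ≤ m) (h2 : m ≤ t) :
    cost c D m t ≤ cost c D s t := by
  rw [← cost_add D h1 h2]; omega

theorem cost_union {D D' : Finset ℕ} (h : Disjoint D D') (s t : ℕ) :
    cost c (D ∪ D') s t = cost c D s t + cost c D' s t := by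
  unfold cost
  rw [← Finset.sum_add_distrib]
  refine Finset.sum_congr rfl fun i _ => ?_
  rw [Finset.filter_union, Finset.card_union_of_disjoint (Finset.disjoint_filter_filter h)]

theorem exists_switch {P : ℕ → Prop} {s t : ℕ} (hst : s ≤ t) (hs : P s) (ht : ¬ P t) :
    ∃ i, s ≤ i ∧ i < t ∧ P i ∧ ¬ P (i + 1) := by
  by_contra! h
  have : ∀ i, s ≤ i → i ≤ t → P i := fun i hi => Nat.le_induction (fun _ => hs)
    (fun i hi ih hit => h i hi (by omega) (ih (by omega))) i hi
  exact ht (this t hst le_rfl)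

theorem exists_last_switch {P : ℕ → Prop} {s t : ℕ} (hst : s ≤ t) (hs : P s) (ht : ¬ P t) :
    ∃ i, s ≤ i ∧ i < t ∧ P i ∧ ∀ j, i < j → j ≤ t → ¬ P j := by
  classical
  have h := Nat.findGreatest_spec (P := P) hst hs
  have h1 := Nat.findGreatest_le (P := P) t
  refine ⟨Nat.findGreatest P t, Nat.le_findGreatest hst hs, ?_, h, fun j hj hjt =>
    Nat.findGreatest_is_greatest hj hjt⟩
  rcases h1.lt_or_eq with h2 | h2
  · exact h2
  · rw [h2] at h
    exact absurd h ht

theorem one_le_cost {k : ℕ} {s t : ℕ} (hst : s ≤ t) (h : c t k ≠ c s k) :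
    1 ≤ cost c {k} s t := by
  obtain ⟨i, h1, h2, h3, h4⟩ := exists_switch (P := fun i => c i k = c s k) hst rfl h
  have h5 : ({k} : Finset ℕ).filter (fun k => c (i + 1) k ≠ c i k) = {k} := by
    rw [Finset.filter_singleton, if_pos]
    rw [h3]
    exact h4
  calc 1 = (({k} : Finset ℕ).filter (fun k => c (i + 1) k ≠ c i k)).card := by simp [h5]
    _ ≤ _ := Finset.single_le_sum
      (f := fun i => (({k} : Finset ℕ).filter (fun k => c (i + 1) k ≠ c i k)).card)
      (fun _ _ => Nat.zero_le _) (Finset.mem_Ico.2 ⟨h1, h2⟩)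

/-- The path `c`, run backwards from the time `t`. -/
def reversed (c : ℕ → ℕ → Fin 4) (t : ℕ) : ℕ → ℕ → Fin 4 := fun i => c (t - i)

theorem Legal.reversed (hc : Legal c) (t : ℕ) : Legal (reversed c t) := by
  intro i k hk j hj
  unfold Hanoi.reversed at *
  rcases lt_or_ge i t with h | h
  · have h1 : t - i = t - (i + 1) + 1 := by omega
    rw [h1] at hk ⊢
    obtain ⟨h2, h3, h4⟩ := hc _ _ hk.symm j hj
    exact ⟨h2.symm, by rwa [h2], by rwa [h2]⟩
  · have h1 : t - i = t - (i + 1) := by omega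
    rw [h1] at hk
    exact absurd rfl hk

theorem cost_reversed (D : Finset ℕ) {s t : ℕ} (hst : s ≤ t) :
    cost (reversed c t) D 0 (t - s) = cost c D s t := by
  unfold cost reversed
  rcases hst.eq_or_lt with rfl | hlt
  · simp
  have h := Finset.sum_Ico_reflect (fun i => (D.filter (fun k => c i k ≠ c (i + 1) k)).card) 0
    (m := t - s) (n := t - 1) (by omega)
  have h1 : t - 1 + 1 - (t - s) = s := by omega
  have h2 : t - 1 + 1 - 0 = t := by omega
  rw [h1, h2] at h
  have h3 : ∀ i, (D.filter (fun k => c (i + 1) k ≠ c i k)).card =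
      (D.filter (fun k => c i k ≠ c (i + 1) k)).card := fun i => by simp only [ne_comm]
  rw [Finset.sum_congr rfl fun i _ => h3 i, ← h]
  refine Finset.sum_congr rfl fun i hi => ?_
  rw [Finset.mem_Ico] at hi
  have h4 : t - (i + 1) = t - 1 - i := by omega
  have h5 : t - i = t - 1 - i + 1 := by omega
  rw [h4, h5]

/-! ### Transfers that avoid one of the four pegs -/

theorem exists_fourth_peg : ∀ a b p : Fin 4, a ≠ b → a ≠ p → b ≠ p →
    ∃ q, q ≠ a ∧ q ≠ b ∧ q ≠ p ∧ ∀ x, x = a ∨ x = b ∨ x = p ∨ x = q := by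
  decide

theorem exists_other_pegs : ∀ a x : Fin 4, a ≠ x →
    ∃ y z, y ≠ a ∧ y ≠ x ∧ z ≠ a ∧ z ≠ x ∧ ∀ w, w = a ∨ w = x ∨ w = y ∨ w = z := by
  decide

/-- With only three pegs, moving a tower takes exponentially many moves. -/
theorem two_pow_card_le_cost (hc : Legal c) (D : Finset ℕ) {s t : ℕ} {a y q : Fin 4} (hst : s ≤ t)
    (hay : a ≠ y) (haq : a ≠ q) (hyq : y ≠ q) (hs : ∀ k ∈ D, c s k = a) (ht : ∀ k ∈ D, c t k = y)
    (hq : ∀ k ∈ D, ∀ i, s ≤ i → i ≤ t → c i k ≠ q) : 2 ^ D.card ≤ cost c D s t + 1 := by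
  induction D using Finset.induction_on_max generalizing s t a y with
  | empty => simp
  | insert N D hN ih =>
    have hND : N ∉ D := fun h => lt_irrefl _ (hN N h)
    have hsN := hs N (Finset.mem_insert_self _ _)
    have htN := ht N (Finset.mem_insert_self _ _)
    have hqN := hq N (Finset.mem_insert_self _ _)
    replace hs := fun k hk => hs k (Finset.mem_insert_of_mem hk)
    replace ht := fun k hk => ht k (Finset.mem_insert_of_mem hk)
    replace hq := fun k hk => hq k (Finset.mem_insert_of_mem hk)
    obtain ⟨i, hsi, hit, hia, hix⟩ := exists_switch (P := fun i => c i N = a) hst hsN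
      (by rw [htN]; exact hay.symm)
    have hxq : c (i + 1) N ≠ q := hqN _ (by omega) (by omega)
    have hmove := hc i N (by rw [hia]; exact hix)
    rw [hia] at hmove
    obtain ⟨r, hra, hrx, hrq, hr⟩ := exists_fourth_peg a (c (i + 1) N) q (Ne.symm hix) haq hxq
    have hDi : ∀ k ∈ D, c i k = r := fun k hk => by
      obtain ⟨-, h2, h3⟩ := hmove k (hN k hk)
      rcases hr (c i k) with h | h | h | h
      · exact absurd h h2
      · exact absurd h h3
      · exact absurd h (hq k hk i hsi hit.le)
      · exact h
    have hDi' : ∀ k ∈ D, c (i + 1) k = r := fun k hk => by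
      rw [(hmove k (hN k hk)).1, hDi k hk]
    have h1 := ih hsi hra.symm haq hrq hs hDi fun k hk j hj hj' => hq k hk j hj (by omega)
    have h2 : 2 ^ D.card ≤ cost c D (i + 1) t + 1 := by
      by_cases hxy : c (i + 1) N = y
      · exact ih (by omega) (by rw [← hxy]; exact hrx) hrq hyq hDi' ht
          fun k hk j hj hj' => hq k hk j (by omega) hj'
      -- If `N` first goes elsewhere than `y`, the other disks are on `y` at that moment and must
      -- leave it before `N` can arrive.
      · have hry : r = y := by
          rcases hr y with h | h | h | h
          · exact absurd h hay.symm
          · exact absurd h.symm hxy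
          · exact absurd h hyq
          · exact h.symm
        obtain ⟨j, hj1, hj2, hj3, hj4⟩ := exists_switch (P := fun i => c i N ≠ y)
          (show i + 1 ≤ t by omega) hxy (by rw [not_not]; exact htN)
        rw [not_not] at hj4
        have hmove' := hc j N (by rw [hj4]; exact hj3.symm)
        rw [hj4] at hmove'
        obtain ⟨r', hr1, hr2, hr3, hr'⟩ := exists_fourth_peg (c j N) y q hj3
          (hqN j (by omega) (by omega)) hyq
        have hDj : ∀ k ∈ D, c j k = r' := fun k hk => by
          obtain ⟨-, h2, h3⟩ := hmove' k (hN k hk)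
          rcases hr' (c j k) with h | h | h | h
          · exact absurd h h2
          · exact absurd h h3
          · exact absurd h (hq k hk j (by omega) (by omega))
          · exact h
        have h3 := ih hj1 (by rw [hry]; exact hr2.symm) hrq hr3 hDi' hDj
          fun k hk m hm hm' => hq k hk m (by omega) (by omega)
        have h4 := cost_mono_right (c := c) D hj1 hj2.le
        omega
    have h3 : cost c (insert N D) s t = cost c {N} s t + cost c D s t := by
      rw [Finset.insert_eq, cost_union (Finset.disjoint_singleton_left.2 hND)]
    have h4 : 1 ≤ cost c {N} s t := one_le_cost hst (by rw [hsN, htN]; exact hay.symm)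
    have h5 := cost_add (c := c) D hsi (show i ≤ t by omega)
    have h6 := cost_mono_left (c := c) D (show i ≤ i + 1 by omega) (show i + 1 ≤ t by omega)
    rw [Finset.card_insert_of_notMem hND, pow_succ]
    omega

/-! ### Bousch's bound, by induction on the number of disks -/

/-- Bousch's bound for the `M` smallest disks: if two pegs end up without any of these disks, then
the number of their moves is at least the weight of the set of those that started on one of
these pegs. -/
def Clears (M : ℕ) : Prop :=
  ∀ c, Legal c → ∀ s t, s ≤ t → ∀ a b, a ≠ b → (∀ k < M, c t k ≠ a ∧ c t k ≠ b) →
    ∀ L, psi L ((Finset.range M).filter (fun k => c s k = a)) ≤ cost c (Finset.range M) s t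

theorem Clears.reversed {M : ℕ} (h : Clears M) (hc : Legal c) {s t : ℕ} (hst : s ≤ t)
    {a b : Fin 4} (hab : a ≠ b) (hs : ∀ k < M, c s k ≠ a ∧ c s k ≠ b) (L : ℕ) :
    psi L ((Finset.range M).filter (fun k => c t k = a)) ≤ cost c (Finset.range M) s t := by
  have h1 := h (Hanoi.reversed c t) (hc.reversed t) 0 (t - s) (Nat.zero_le _) a b hab
    (by simpa [Hanoi.reversed, Nat.sub_sub_self hst] using hs) L
  rw [cost_reversed _ hst] at h1
  simpa [Hanoi.reversed] using h1

/-- The source and target of a moving disk `k ≥ M` are free of the disks below `M`, so they form the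
cleared pair, and either one may play the role of `y`. -/
theorem Clears.psi_le_of_move {M : ℕ} (h : Clears M) (hc : Legal c) {s i k : ℕ} {y : Fin 4}
    (hMk : M ≤ k) (hsi : s ≤ i) (hne : c (i + 1) k ≠ c i k) (hy : y = c i k ∨ y = c (i + 1) k)
    (L : ℕ) :
    psi L ((Finset.range M).filter (fun k => c s k = y)) ≤ cost c (Finset.range M) s i := by
  have hm := hc i k hne
  rcases hy with rfl | rfl
  · exact h c hc s i hsi _ _ hne.symm (fun j hj => (hm j (by omega)).2) L
  · exact h c hc s i hsi _ _ hne (fun j hj => (hm j (by omega)).2.symm) L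

theorem Clears.psi_le_of_move_reversed {M : ℕ} (h : Clears M) (hc : Legal c) {i t k : ℕ}
    {y : Fin 4} (hMk : M ≤ k) (hit : i + 1 ≤ t) (hne : c (i + 1) k ≠ c i k)
    (hy : y = c i k ∨ y = c (i + 1) k) (L : ℕ) :
    psi L ((Finset.range M).filter (fun k => c t k = y)) ≤
      cost c (Finset.range M) (i + 1) t := by
  have hm := hc i k hne
  rcases hy with rfl | rfl
  · refine h.reversed hc hit hne.symm (fun j hj => ?_) L
    rw [(hm j (by omega)).1]
    exact (hm j (by omega)).2
  · refine h.reversed hc hit hne (fun j hj => ?_) L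
    rw [(hm j (by omega)).1]
    exact (hm j (by omega)).2.symm

theorem exists_max_mem {E : Finset ℕ} {P : ℕ → Prop} (h : ∃ k ∈ E, P k) :
    ∃ T ∈ E, P T ∧ ∀ k ∈ E, T < k → ¬ P k := by
  classical
  obtain ⟨k, hk, hPk⟩ := h
  obtain ⟨T, hT, hmax⟩ := (E.filter P).exists_max_image id ⟨k, Finset.mem_filter.2 ⟨hk, hPk⟩⟩
  rw [Finset.mem_filter] at hT
  exact ⟨T, hT.1, hT.2, fun j hj hTj hPj =>
    absurd (hmax j (Finset.mem_filter.2 ⟨hj, hPj⟩)) (not_le.2 hTj)⟩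

theorem clears_succ {N : ℕ} (ih : ∀ M ≤ N, Clears M) : Clears (N + 1) := by
  intro c hc s t hst a b hab ht L
  have hcostN : cost c (Finset.range (N + 1)) s t =
      cost c {N} s t + cost c (Finset.range N) s t := by
    rw [Finset.range_add_one, Finset.insert_eq, cost_union (by simp)]
  by_cases haN : c s N = a
  swap
  · have h1 := ih N le_rfl c hc s t hst a b hab (fun k hk => ht k (by omega)) L
    rw [Finset.range_add_one, Finset.filter_insert, if_neg haN, ← Finset.range_add_one]
    exact h1.trans (by exact_mod_cast cost_mono (Finset.range_mono (Nat.le_succ N)) s t)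
  obtain ⟨E, hEdef⟩ : ∃ E, E = (Finset.range (N + 1)).filter (fun k => c s k = a) := ⟨_, rfl⟩
  obtain ⟨E₀, hE₀def⟩ : ∃ E₀, E₀ = (Finset.range N).filter (fun k => c s k = a) := ⟨_, rfl⟩
  have hE : E = insert N E₀ := by
    rw [hEdef, hE₀def, Finset.range_add_one, Finset.filter_insert, if_pos haN]
  rw [← hEdef]
  have hNE₀ : N ∉ E₀ := by simp [hE₀def]
  -- It suffices to treat a level at which `E` has more than `L` elements of root at least `L`, or
  -- level zero.
  obtain ⟨L', hle, hL⟩ := exists_psi_le L E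
  refine hle.trans ?_
  clear hle L
  rename ℕ => L
  have hpsiE : psi L E ≤ psi L E₀ + 2 ^ L := by
    rw [hE, psi, psi, Finset.sum_insert hNE₀]
    have : (2 : ℤ) ^ min (triRoot N) L ≤ 2 ^ L := pow_le_pow_right₀ (by norm_num) (by omega)
    linarith
  have hpa : c t N ≠ a := (ht N (by omega)).1
  have hpb : c t N ≠ b := (ht N (by omega)).2
  obtain ⟨t₀, hst₀, ht₀t, ht₀a, hlast⟩ := exists_last_switch (P := fun i => c i N = a) hst haN hpa
  have hxa : c (t₀ + 1) N ≠ a := hlast (t₀ + 1) (by omega) (by omega)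
  have hne : c (t₀ + 1) N ≠ c t₀ N := by rw [ht₀a]; exact hxa
  have hw : ∀ k < N, c (t₀ + 1) k ≠ a ∧ c (t₀ + 1) k ≠ c (t₀ + 1) N := fun k hk => by
    obtain ⟨h1, h2, h3⟩ := hc t₀ N hne k hk
    rw [h1]
    rw [ht₀a] at h2
    exact ⟨h2, h3⟩
  have hN1 : 1 ≤ cost c {N} s t := one_le_cost hst (by rw [haN]; exact hpa)
  have hadd := cost_add (c := c) (Finset.range N) (show s ≤ t₀ + 1 by omega)
    (show t₀ + 1 ≤ t by omega)
  have hpre : ∀ l, psi l E₀ ≤ cost c (Finset.range N) s (t₀ + 1) := fun l => by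
    rw [hE₀def]
    refine ((ih N le_rfl).psi_le_of_move hc le_rfl hst₀ hne (Or.inl ht₀a.symm) l).trans ?_
    exact_mod_cast cost_mono_right _ hst₀ (Nat.le_succ t₀)
  rw [hcostN, ← hadd]
  -- The weight of `N` is at most `2 ^ L`, and the summand 1 on the right is a move of `N` itself.
  suffices h : psi L E₀ + 2 ^ L ≤
      cost c (Finset.range N) s (t₀ + 1) + cost c (Finset.range N) (t₀ + 1) t + 1 by
    push_cast
    have : (1 : ℤ) ≤ cost c {N} s t := by exact_mod_cast hN1
    linarith
  have hafter : (2 : ℤ) ^ L ≤ cost c (Finset.range N) (t₀ + 1) t + 1 →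
      psi L E₀ + 2 ^ L ≤
        cost c (Finset.range N) s (t₀ + 1) + cost c (Finset.range N) (t₀ + 1) t + 1 :=
    fun h => by linarith [hpre L]
  have hvisit : ∀ y τ, y ≠ c (t₀ + 1) N → t₀ + 1 ≤ τ → τ ≤ t → c τ N = y → ∀ l,
      psi l ((Finset.range N).filter (fun k => c (t₀ + 1) k = y)) ≤
        cost c (Finset.range N) (t₀ + 1) t := by
    intro y τ hyx hτ hτt hτy l
    obtain ⟨i, h1, h2, h3, h4⟩ := exists_switch (P := fun i => c i N ≠ y) hτ hyx.symm
      (by rw [not_not]; exact hτy)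
    rw [not_not] at h4
    refine ((ih N le_rfl).psi_le_of_move hc le_rfl h1 (by rw [h4]; exact h3.symm)
      (Or.inr h4.symm) l).trans ?_
    exact_mod_cast cost_mono_right _ h1 (by omega)
  obtain ⟨q, hqa, hqb, hqp, hq⟩ := exists_fourth_peg a b (c t N) hab hpa.symm hpb.symm
  -- Peg `b` is cleared because it is free at the end, and the final peg of `N` because `N` has yet
  -- to land there; only `q` needs a visit as a hypothesis.
  have hclear : ∀ y, y ≠ a → y ≠ c (t₀ + 1) N → (y = q → ∃ τ, t₀ + 1 ≤ τ ∧ τ ≤ t ∧ c τ N = q) →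
      ∀ l, psi l ((Finset.range N).filter (fun k => c (t₀ + 1) k = y)) ≤
        cost c (Finset.range N) (t₀ + 1) t := by
    intro y hya hyx hyq l
    rcases hq y with rfl | rfl | rfl | rfl
    · exact absurd rfl hya
    · exact ih N le_rfl c hc _ _ (by omega) y a hya (fun k hk => (ht k (by omega)).symm) l
    · exact hvisit _ t hyx (by omega) le_rfl rfl l
    · obtain ⟨τ, h1, h2, h3⟩ := hyq rfl
      exact hvisit _ τ hyx h1 h2 h3 l
  have htwo : ∀ y z, (∀ v, v = a ∨ v = c (t₀ + 1) N ∨ v = y ∨ v = z) → ∀ C : ℕ,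
      (∀ l, psi l ((Finset.range N).filter (fun k => c (t₀ + 1) k = y)) ≤ C) →
      (∀ l, psi l ((Finset.range N).filter (fun k => c (t₀ + 1) k = z)) ≤ C) →
      (2 : ℤ) ^ L ≤ C + 1 := by
    intro y z hyz C hy hz
    refine two_pow_le_of_range_subset (N := N) (by rw [hEdef]; exact Finset.filter_subset _ _) hL
      (fun k hk => ?_) hy hz
    have h1 := hw k (Finset.mem_range.1 hk)
    simp only [Finset.mem_union, Finset.mem_filter, hk, true_and]
    rcases hyz (c (t₀ + 1) k) with h | h | h | h
    · exact absurd h h1.1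
    · exact absurd h h1.2
    · exact Or.inl h
    · exact Or.inr h
  by_cases hqafter : ∃ τ, t₀ + 1 ≤ τ ∧ τ ≤ t ∧ c τ N = q
  · obtain ⟨y, z, hya, hyx, hza, hzx, hyz⟩ := exists_other_pegs a (c (t₀ + 1) N) hxa.symm
    exact hafter (htwo y z hyz _ (hclear y hya hyx fun _ => hqafter)
      (hclear z hza hzx fun _ => hqafter))
  push Not at hqafter
  have hxq : c (t₀ + 1) N ≠ q := hqafter _ le_rfl (by omega)
  obtain ⟨y, hya, hyx, hyq, hy⟩ := exists_fourth_peg a (c (t₀ + 1) N) q hxa.symm hqa.symm hxq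
  have hclear_y := hclear y hya hyx fun h => absurd h hyq
  -- Cut at an arrival of `N` on `q`. The weight of `E₀` is paid before it, since `N` has left `a`;
  -- the disks found on `q` at time `t₀ + 1` all came after it, which reversed time accounts for.
  by_cases hqbefore : ∃ τ, s ≤ τ ∧ τ ≤ t₀ ∧ c τ N = q
  · obtain ⟨τ, hτs, hτt₀, hτ⟩ := hqbefore
    obtain ⟨i, h1, h2, h3, h4⟩ := exists_switch (P := fun i => c i N ≠ q) hτs
      (by rw [haN]; exact hqa.symm) (by rw [not_not]; exact hτ)
    rw [not_not] at h4
    have h5 : ∀ l, psi l E₀ ≤ cost c (Finset.range N) s (i + 1) := fun l => by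
      obtain ⟨j, h6, h7, h8, h9⟩ := exists_switch (P := fun i => c i N = a)
        (show s ≤ i + 1 by omega) haN (by rw [h4]; exact hqa)
      rw [hE₀def]
      refine ((ih N le_rfl).psi_le_of_move hc le_rfl h6 (by rw [h8]; exact h9)
        (Or.inl h8.symm) l).trans ?_
      exact_mod_cast cost_mono_right _ h6 (by omega)
    have h6 := fun l => (ih N le_rfl).psi_le_of_move_reversed hc le_rfl
      (show i + 1 ≤ t₀ + 1 by omega) (by rw [h4]; exact h3.symm) (Or.inr h4.symm) l
    have h7 := htwo y q (fun v => by rcases hy v with h | h | h | h <;> simp [h])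
      (cost c (Finset.range N) (i + 1) (t₀ + 1) + cost c (Finset.range N) (t₀ + 1) t)
      (fun l => (hclear_y l).trans (by push_cast; linarith))
      (fun l => (h6 l).trans (by push_cast; linarith))
    have h8 := cost_add (c := c) (Finset.range N) (show s ≤ i + 1 by omega)
      (show i + 1 ≤ t₀ + 1 by omega)
    rw [← h8]
    push_cast at h7 ⊢
    linarith [h5 L]
  push Not at hqbefore
  have hNq : ∀ τ, s ≤ τ → τ ≤ t → c τ N ≠ q := fun τ h1 h2 => by
    rcases Nat.lt_or_ge t₀ τ with h | h
    · exact hqafter τ h h2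
    · exact hqbefore τ h1 h
  have hE₀ : ∀ k, k ∈ E₀ ↔ k < N ∧ c s k = a := fun k => by
    rw [hE₀def, Finset.mem_filter, Finset.mem_range]
  -- The disks of `E₀` that avoid `q` are all on `y` at time `t₀ + 1`, so each of the two phases
  -- contains a three-peg transfer.
  have htower : ∀ G ⊆ E₀, (∀ k ∈ G, ∀ τ, s ≤ τ → τ ≤ t → c τ k ≠ q) →
      2 ^ G.card ≤ cost c G s (t₀ + 1) + 1 ∧ 2 ^ G.card ≤ cost c G (t₀ + 1) t + 1 := by
    intro G hGE hGq
    have hGN : ∀ k ∈ G, k < N ∧ c s k = a := fun k hk => (hE₀ k).1 (hGE hk)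
    have hGw : ∀ k ∈ G, c (t₀ + 1) k = y := fun k hk => by
      have h1 := hw k (hGN k hk).1
      have h2 := hGq k hk (t₀ + 1) (by omega) (by omega)
      rcases hy (c (t₀ + 1) k) with h | h | h | h
      · exact absurd h h1.1
      · exact absurd h h1.2
      · exact absurd h h2
      · exact h
    refine ⟨two_pow_card_le_cost hc G (by omega) hya.symm hqa.symm hyq
      (fun k hk => (hGN k hk).2) hGw fun k hk i h1 h2 => hGq k hk i h1 (by omega), ?_⟩
    -- If `N` ends on `y`, it has yet to land there, and `G` must then be on the only peg left;
    -- otherwise `G` itself ends on the final peg of `N`.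
    by_cases hyp : y = c t N
    · obtain ⟨i, h1, h2, h3, h4⟩ := exists_switch (P := fun i => c i N ≠ y)
        (show t₀ + 1 ≤ t by omega) hyx.symm (by rw [not_not]; exact hyp.symm)
      rw [not_not] at h4
      have hmove := hc i N (by rw [h4]; exact h3.symm)
      rw [h4] at hmove
      obtain ⟨r, hr1, hr2, hr3, hr⟩ := exists_fourth_peg (c i N) y q h3
        (hNq i (by omega) (by omega)) hyq
      have h5 := two_pow_card_le_cost hc G h1 hr2.symm hyq hr3 hGw (fun k hk => by
          have h6 := hmove k (hGN k hk).1
          have h7 := hGq k hk i (by omega) (by omega)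
          rcases hr (c i k) with h | h | h | h
          · exact absurd h h6.2.1
          · exact absurd h h6.2.2
          · exact absurd h h7
          · exact h) fun k hk j h1 h2 => hGq k hk j (by omega) (by omega)
      have h6 := cost_mono_right (c := c) G h1 h2.le
      omega
    · refine two_pow_card_le_cost hc G (by omega) hyp hyq hqp.symm hGw (fun k hk => ?_)
        fun k hk j h1 h2 => hGq k hk j (by omega) (by omega)
      have h6 := ht k (by have := (hGN k hk).1; omega)
      have h7 := hGq k hk t (by omega) (by omega)
      rcases hq (c t k) with h | h | h | h
      · exact absurd h h6.1
      · exact absurd h h6.2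
      · exact h
      · exact absurd h h7
  have hfew : ∀ G ⊆ E₀, (∀ k ∈ G, ∀ τ, s ≤ τ → τ ≤ t → c τ k ≠ q) → L ≤ G.card →
      (2 : ℤ) ^ L ≤ cost c (Finset.range N) (t₀ + 1) t + 1 := by
    intro G hGE hGq hLG
    have h1 := (htower G hGE hGq).2
    have h2 := cost_mono (c := c) (D := G) (D' := Finset.range N)
      (fun k hk => Finset.mem_range.2 ((hE₀ k).1 (hGE hk)).1) (t₀ + 1) t
    have h3 : 2 ^ L ≤ 2 ^ G.card := Nat.pow_le_pow_right (by norm_num) hLG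
    exact_mod_cast (show 2 ^ L ≤ cost c (Finset.range N) (t₀ + 1) t + 1 by omega)
  by_cases hV : ∃ k ∈ E₀, ∃ τ, s ≤ τ ∧ τ ≤ t ∧ c τ k = q
  swap
  · push Not at hV
    refine hafter (hfew E₀ subset_rfl hV ?_)
    have h1 := Finset.card_filter_le E (fun n => L ≤ triRoot n)
    have h2 : E.card = E₀.card + 1 := by rw [hE, Finset.card_insert_of_notMem hNE₀]
    omega
  -- The new pivot: the disks of `E₀` above `T` form a tower confined to three pegs, and the
  -- induction hypothesis is applied to those below `T`.
  obtain ⟨T, hTE, ⟨τ, hsτ, hτt, hτq⟩, hTmax⟩ := exists_max_mem hV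
  obtain ⟨hTN, hsT⟩ := (hE₀ T).1 hTE
  obtain ⟨G, hGdef⟩ : ∃ G, G = E₀.filter (fun k => T < k) := ⟨_, rfl⟩
  have hGE : G ⊆ E₀ := by rw [hGdef]; exact Finset.filter_subset _ _
  have hTG : ∀ k ∈ G, T < k := fun k hk => by
    rw [hGdef] at hk
    exact (Finset.mem_filter.1 hk).2
  have hGq : ∀ k ∈ G, ∀ τ, s ≤ τ → τ ≤ t → c τ k ≠ q := fun k hk τ h1 h2 h3 =>
    hTmax k (hGE hk) (hTG k hk) ⟨τ, h1, h2, h3⟩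
  rcases le_or_gt L G.card with hLG | hLG
  · exact hafter (hfew G hGE hGq hLG)
  replace hL : L + 1 ≤ (E.filter (fun n => L ≤ triRoot n)).card := by omega
  have hcard : tri L + (L + 1) ≤ T + 1 + (insert N G).card :=
    le_triRoot_of_lt_card (fun k hk hTk => by
      rw [hE] at hk
      rcases Finset.mem_insert.1 hk with h | h
      · exact Finset.mem_insert.2 (Or.inl h)
      · refine Finset.mem_insert_of_mem ?_
        rw [hGdef]
        exact Finset.mem_filter.2 ⟨h, hTk⟩) ((Finset.card_insert_le _ _).trans hLG) hL
  have hGcard := Finset.card_insert_le N G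
  -- At most `L` disks of `E` exceed `T`, namely `N` and those of `G`, so some disk of root at least
  -- `L` is at most `T`.
  have hLT : L ≤ triRoot T := le_triRoot.2 (by omega)
  have hparts : ∀ s t, cost c (Finset.range T) s t + cost c {T} s t + cost c G s t ≤
      cost c (Finset.range N) s t := fun s t => by
    rw [← cost_union (by simp), ← cost_union]
    · refine cost_mono (fun k hk => ?_) s t
      rw [Finset.mem_range]
      simp only [Finset.mem_union, Finset.mem_range, Finset.mem_singleton] at hk
      rcases hk with (h | h) | h
      · omega
      · omega
      · exact ((hE₀ k).1 (hGE h)).1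
    · rw [Finset.disjoint_right]
      intro k hk hk'
      have := hTG k hk
      simp only [Finset.mem_union, Finset.mem_range, Finset.mem_singleton] at hk'
      omega
  obtain ⟨A, hA⟩ : ∃ A, A = (Finset.range T).filter (fun k => c (t₀ + 1) k = y) := ⟨_, rfl⟩
  obtain ⟨B, hB⟩ : ∃ B, B = (Finset.range T).filter (fun k => c (t₀ + 1) k = q) := ⟨_, rfl⟩
  have hAT : A ⊆ Finset.range T := by rw [hA]; exact Finset.filter_subset _ _
  have hAB : Finset.range T ⊆ A ∪ B := fun k hk => by
    have h1 := hw k ((Finset.mem_range.1 hk).trans hTN)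
    rw [hA, hB]
    simp only [Finset.mem_union, Finset.mem_filter, hk, true_and]
    rcases hy (c (t₀ + 1) k) with h | h | h | h
    · exact absurd h h1.1
    · exact absurd h h1.2
    · exact Or.inr h
    · exact Or.inl h
  have hAw : ∀ k ∈ A, k < N ∧ c (t₀ + 1) k = y := fun k hk => by
    rw [hA, Finset.mem_filter, Finset.mem_range] at hk
    exact ⟨hk.1.trans hTN, hk.2⟩
  have hGw : ∀ k ∈ G, k < N ∧ c (t₀ + 1) k = y := fun k hk => by
    have hkN := ((hE₀ k).1 (hGE hk)).1
    have h1 := hw k hkN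
    refine ⟨hkN, ?_⟩
    rcases hy (c (t₀ + 1) k) with h | h | h | h
    · exact absurd h h1.1
    · exact absurd h h1.2
    · exact absurd h (hGq k hk _ (by omega) (by omega))
    · exact h
  have hclear_sub : ∀ F : Finset ℕ, (∀ k ∈ F, k < N ∧ c (t₀ + 1) k = y) →
      ∀ l, psi l F ≤ cost c (Finset.range N) (t₀ + 1) t := fun F hF l =>
    (psi_mono l fun k hk => Finset.mem_filter.2
      ⟨Finset.mem_range.2 (hF k hk).1, (hF k hk).2⟩).trans (hclear_y l)
  -- If `T` reaches `q` before `N` leaves `a` for good, its arrival splits the first phase: the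
  -- disks below `T` pay for `E'` before it and for `B` after it, while `G` and `T` pay `2 ^
  -- G.card`. The second phase pays for `A ∪ G`.
  by_cases hearly : ∃ τ, s ≤ τ ∧ τ ≤ t₀ + 1 ∧ c τ T = q
  · clear! τ
    obtain ⟨τ, hsτ, hτt, hτq⟩ := hearly
    obtain ⟨E', hE'⟩ : ∃ E', E' = (Finset.range T).filter (fun k => c s k = a) := ⟨_, rfl⟩
    obtain ⟨i, h1, h2, h3, h4⟩ := exists_switch (P := fun i => c i T ≠ q) hsτ
      (by rw [hsT]; exact hqa.symm) (by rw [not_not]; exact hτq)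
    rw [not_not] at h4
    have h5 : ∀ l, psi l E' ≤ cost c (Finset.range T) s (i + 1) := fun l => by
      obtain ⟨j, h6, h7, h8, h9⟩ := exists_switch (P := fun i => c i T = a)
        (show s ≤ i + 1 by omega) hsT (by rw [h4]; exact hqa)
      rw [hE']
      refine ((ih T hTN.le).psi_le_of_move hc le_rfl h6 (by rw [h8]; exact h9)
        (Or.inl h8.symm) l).trans ?_
      exact_mod_cast cost_mono_right _ h6 (by omega)
    have h6 : ∀ l, psi l B ≤ cost c (Finset.range T) (i + 1) (t₀ + 1) := fun l => by
      rw [hB]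
      exact (ih T hTN.le).psi_le_of_move_reversed hc le_rfl
        (by omega) (by rw [h4]; exact h3.symm) (Or.inr h4.symm) l
    have h7 := psi_le_of_early_visit (E := E') (A := A) (B := B) (G := G) hLG hLT
      (by rw [hE']; exact Finset.filter_subset _ _) hAB hAT hTG h5 h6
      (hclear_sub (A ∪ G) fun k hk => (Finset.mem_union.1 hk).elim (hAw k) (hGw k))
    have h8 : psi L E₀ = psi L E' + (G.card + 1) * 2 ^ L := by
      have hTnG : T ∉ G := fun h => lt_irrefl _ (hTG T h)
      have h9 : E₀ = E' ∪ insert T G := by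
        ext k
        rw [hE', hGdef]
        simp only [Finset.mem_union, Finset.mem_filter, Finset.mem_range, Finset.mem_insert, hE₀]
        constructor
        · rintro ⟨h10, h11⟩
          rcases lt_trichotomy k T with h | h | h
          · exact Or.inl ⟨h, h11⟩
          · exact Or.inr (Or.inl h)
          · exact Or.inr (Or.inr ⟨⟨h10, h11⟩, h⟩)
        · rintro (⟨h10, h11⟩ | h10 | h10)
          · exact ⟨h10.trans hTN, h11⟩
          · rw [h10]
            exact ⟨hTN, hsT⟩
          · exact h10.1
      rw [h9, psi_union_of_disjoint L, Finset.card_insert_of_notMem hTnG]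
      · push_cast
        rfl
      · rw [Finset.disjoint_left]
        intro k hk hk'
        rw [hE', Finset.mem_filter, Finset.mem_range] at hk
        rcases Finset.mem_insert.1 hk' with h | h
        · omega
        · have := hTG k h
          omega
      · intro g hg
        rcases Finset.mem_insert.1 hg with h | h
        · rw [h]
          exact hLT
        · exact le_triRoot.2 ((le_triRoot.1 hLT).trans (hTG g h).le)
    have h9 := hparts s (t₀ + 1)
    have h10 := (htower G hGE hGq).1
    have h11 : 1 ≤ cost c {T} s (t₀ + 1) :=
      (one_le_cost hsτ (by rw [hsT, hτq]; exact hqa)).trans (cost_mono_right _ hsτ hτt)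
    have h12 := cost_add (c := c) (Finset.range T) (show s ≤ i + 1 by omega)
      (show i + 1 ≤ t₀ + 1 by omega)
    have h13 : ((cost c (Finset.range T) s (i + 1) : ℕ) : ℤ) +
        cost c (Finset.range T) (i + 1) (t₀ + 1) + 2 ^ G.card ≤
        cost c (Finset.range N) s (t₀ + 1) := by
      exact_mod_cast (show cost c (Finset.range T) s (i + 1) +
        cost c (Finset.range T) (i + 1) (t₀ + 1) + 2 ^ G.card ≤
        cost c (Finset.range N) s (t₀ + 1) by omega)
    rw [h8]
    linarith
  · push Not at hearly
    have hτ : t₀ + 1 < τ := by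
      by_contra h
      exact hearly τ hsτ (by omega) hτq
    have hwT : c (t₀ + 1) T = y := by
      have h1 := hw T hTN
      rcases hy (c (t₀ + 1) T) with h | h | h | h
      · exact absurd h h1.1
      · exact absurd h h1.2
      · exact absurd h (hearly _ (by omega) le_rfl)
      · exact h
    -- Otherwise `T` is on `y` at time `t₀ + 1`. The second phase alone must clear `B` from `q` to
    -- let `T` in, and must clear `A`, `T` and `G` from `y`.
    refine hafter (two_pow_le_of_late_visit (A := A) (B := B) (G := G) (by omega) hLT (by omega)
      hAB hAT hTG (fun l => ?_) (hclear_sub _ fun k hk => ?_))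
    · obtain ⟨i, h1, h2, h3, h4⟩ := exists_switch (P := fun i => c i T ≠ q) hτ.le
        (by rw [hwT]; exact hyq) (by rw [not_not]; exact hτq)
      rw [not_not] at h4
      have h5 := (ih T hTN.le).psi_le_of_move hc le_rfl h1 (by rw [h4]; exact h3.symm)
        (Or.inr h4.symm) l
      rw [← hB] at h5
      have h6 := cost_mono_right (c := c) (Finset.range T) h1 (show i ≤ t by omega)
      have h7 := hparts (t₀ + 1) t
      have h8 := (htower G hGE hGq).2
      have h9 : 1 ≤ cost c {T} (t₀ + 1) t :=
        (one_le_cost hτ.le (by rw [hwT, hτq]; exact hyq.symm)).trans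
          (cost_mono_right _ hτ.le hτt)
      have h10 : ((cost c (Finset.range T) (t₀ + 1) i : ℕ) : ℤ) + 2 ^ G.card ≤
          cost c (Finset.range N) (t₀ + 1) t := by
        exact_mod_cast (show cost c (Finset.range T) (t₀ + 1) i + 2 ^ G.card ≤
          cost c (Finset.range N) (t₀ + 1) t by omega)
      linarith
    · rcases Finset.mem_union.1 hk with h | h
      · exact hAw k h
      · rcases Finset.mem_insert.1 h with h | h
        · rw [h]
          exact ⟨hTN, hwT⟩
        · exact hGw k h

theorem clears (M : ℕ) : Clears M := by
  induction M using Nat.strong_induction_on with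
  | _ M ih =>
    rcases M with _ | N
    · intro c hc s t hst a b hab ht L
      have : psi L ∅ ≤ 0 := by simpa using psi_le_two_pow_card L ∅
      simpa using this.trans (Nat.cast_nonneg _)
    · exact clears_succ fun M hM => ih M (by omega)

/-! ### Lower bound for the transfer of a tower -/

theorem sum_two_pow_triRoot_le_cost {c : ℕ → ℕ → Fin 4} (hc : Legal c) {n l : ℕ} {a b : Fin 4}
    (hab : a ≠ b) (h0 : ∀ k < n, c 0 k = a) (hl : ∀ k < n, c l k = b) :
    ∑ k ∈ Finset.range n, (2 : ℤ) ^ triRoot k ≤ cost c (Finset.range n) 0 l := by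
  rcases n with _ | N
  · simp
  obtain ⟨i, -, hil, hia, hix⟩ := exists_switch (P := fun i => c i N = a) (Nat.zero_le l)
    (h0 N (by omega)) (by rw [hl N (by omega)]; exact hab.symm)
  obtain ⟨j, hij, hjl, hj1, hj2⟩ : ∃ j, i ≤ j ∧ j < l ∧ c j N ≠ b ∧ c (j + 1) N = b := by
    obtain ⟨j, h1, h2, h3, h4⟩ := exists_switch (P := fun j => c j N ≠ b) hil.le
      (by rw [hia]; exact hab) (by rw [not_not]; exact hl N (by omega))
    exact ⟨j, h1, h2, h3, not_not.1 h4⟩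
  have hpre : ∀ L, psi L (Finset.range N) ≤ cost c (Finset.range N) 0 (j + 1) := fun L => by
    have h1 := (clears N).psi_le_of_move hc le_rfl (Nat.zero_le i) (by rw [hia]; exact hix)
      (Or.inl hia.symm) L
    rw [Finset.filter_true_of_mem fun k hk => h0 k (by have := Finset.mem_range.1 hk; omega)] at h1
    refine h1.trans ?_
    exact_mod_cast cost_mono_right _ (Nat.zero_le i) (by omega)
  have hpost : ∀ L, psi L (Finset.range N) ≤ cost c (Finset.range N) (j + 1) l := fun L => by
    have h1 := (clears N).psi_le_of_move_reversed hc le_rfl (show j + 1 ≤ l by omega)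
      (by rw [hj2]; exact hj1.symm) (Or.inr hj2.symm) L
    rwa [Finset.filter_true_of_mem fun k hk => hl k (by have := Finset.mem_range.1 hk; omega)]
      at h1
  have hadd := cost_add (c := c) (Finset.range N) (Nat.zero_le (j + 1)) (show j + 1 ≤ l by omega)
  have hN1 : 1 ≤ cost c {N} 0 l := one_le_cost (Nat.zero_le l) (by
    rw [h0 N (by omega), hl N (by omega)]
    exact hab.symm)
  have hcost : cost c (Finset.range (N + 1)) 0 l =
      cost c {N} 0 l + cost c (Finset.range N) 0 l := by
    rw [Finset.range_add_one, Finset.insert_eq, cost_union (by simp)]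
  have key : ∑ k ∈ Finset.range (N + 1), (2 : ℤ) ^ triRoot k ≤
      cost c (Finset.range N) 0 (j + 1) + cost c (Finset.range N) (j + 1) l + 1 := by
    obtain ⟨p, r, hr, rfl⟩ := exists_eq_tri_add N
    rw [add_assoc, sum_two_pow_triRoot p (r + 1) (by omega)]
    rcases p with _ | q
    · obtain rfl : r = 0 := by omega
      push_cast
      norm_num
      positivity
    -- The level is one below the root of `N`. Each half costs at least `(q + 1 + r) * 2 ^ q`, and
    -- doubling this plus one is exactly the closed form.
    · have h1 := hpre q
      have h2 := hpost q
      have ht := tri_succ q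
      rw [psi_range q _ (by omega), ht] at h1 h2
      rw [ht]
      push_cast at h1 h2 ⊢
      rw [pow_succ]
      linarith
  rw [hcost, ← hadd]
  push_cast
  have : (1 : ℤ) ≤ cost c {N} 0 l := by exact_mod_cast hN1
  linarith

/-! ### The Frame–Stewart strategy -/

/-- The transfer of the disks from `m` to `j - 1` to the peg `b`. -/
def fill {n : ℕ} (s : Config 4 n) (m j : ℕ) (b : Fin 4) : Config 4 n :=
  fun e => if m ≤ e.val ∧ e.val < j then b else s e

/-- There is a sequence of exactly `l` legal moves from `s` to `t`. -/
def Reaches {n : ℕ} (s t : Config 4 n) (l : ℕ) : Prop :=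
  ∃ c : ℕ → Config 4 n, c 0 = s ∧ c l = t ∧ ∀ i, i < l → IsMove (c i) (c (i + 1))

variable {n : ℕ}

theorem Reaches.refl (s : Config 4 n) : Reaches s s 0 :=
  ⟨fun _ => s, rfl, rfl, fun i hi => absurd hi (Nat.not_lt_zero i)⟩

theorem Reaches.single {s t : Config 4 n} (h : IsMove s t) : Reaches s t 1 := by
  refine ⟨fun i => if i = 0 then s else t, by simp, by simp, fun i hi => ?_⟩
  obtain rfl : i = 0 := by omega
  simpa using h

theorem Reaches.trans {s t u : Config 4 n} {l l' : ℕ} (h : Reaches s t l) (h' : Reaches t u l') :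
    Reaches s u (l + l') := by
  obtain ⟨c, h0, hl, hc⟩ := h
  obtain ⟨c', h0', hl', hc'⟩ := h'
  refine ⟨fun i => if i ≤ l then c i else c' (i - l), by simpa using h0, ?_, fun i hi => ?_⟩
  · rcases Nat.eq_zero_or_pos l' with h | h
    · subst h
      simp [hl, ← hl', h0']
    · simp [show ¬ l + l' ≤ l by omega, hl']
  · rcases lt_trichotomy i l with h | h | h
    · simpa [h.le, show i + 1 ≤ l by omega] using hc i h
    · have := hc' 0 (by omega)
      rw [h0', ← hl] at this
      simpa [h] using this
    · have := hc' (i - l) (by omega)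
      rw [show i - l + 1 = i + 1 - l by omega] at this
      simpa [show ¬ i ≤ l by omega, show ¬ i + 1 ≤ l by omega] using this

/-- The classical recursion on the pegs `a`, `b`, `d`, never using `r`. Disks from `j` on are larger
and may lie anywhere, which lets the induction apply to intermediate arrangements. -/
theorem reaches_fill_three (s : Config 4 n) {m j : ℕ} {a b d r : Fin 4} (hmj : m ≤ j) (hjn : j ≤ n)
    (hab : a ≠ b) (had : a ≠ d) (har : a ≠ r) (hbd : b ≠ d) (hbr : b ≠ r) (hdr : d ≠ r)
    (hsmall : ∀ e : Fin n, e.val < m → s e = r)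
    (hs : ∀ e : Fin n, m ≤ e.val → e.val < j → s e = a) :
    Reaches s (fill s m j b) (2 ^ (j - m) - 1) := by
  induction j, hmj using Nat.le_induction generalizing s a b d with
  | base =>
    have h : fill s m m b = s := by
      funext e
      exact if_neg (by omega)
    rw [h]
    simpa using Reaches.refl s
  | succ j hmj ih =>
    have h1 := ih s (by omega) had hab har hbd.symm hdr hbr hsmall
      fun e h1 h2 => hs e h1 (by omega)
    have h2 : IsMove (fill s m j d) (Function.update (fill s m j d) ⟨j, by omega⟩ b) := by
      have hj : fill s m j d ⟨j, by omega⟩ = a := by simp [fill, hs ⟨j, by omega⟩ hmj]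
      refine ⟨⟨j, by omega⟩, b, by rw [hj]; exact hab.symm, fun e he => ?_, rfl⟩
      have he' : e.val < j := he
      rw [hj]
      unfold fill
      split_ifs with h
      · exact ⟨had.symm, hbd.symm⟩
      · rw [hsmall e (by omega)]
        exact ⟨har.symm, hbr.symm⟩
    obtain ⟨u, hu⟩ : ∃ u, u = Function.update (fill s m j d) (⟨j, by omega⟩ : Fin n) b := ⟨_, rfl⟩
    have hue : ∀ e : Fin n, u e = if e.val = j then b else fill s m j d e := fun e => by
      rw [hu, Function.update_apply]
      simp only [Fin.ext_iff]
    rw [← hu] at h2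
    have h3 := ih (a := d) (b := b) (d := a) u (by omega) hbd.symm had.symm hdr hab.symm hbr har
      (fun e he => by
        rw [hue, if_neg (by omega), fill, if_neg (by omega), hsmall e he])
      (fun e he he' => by rw [hue, if_neg (by omega), fill, if_pos ⟨he, he'⟩])
    have h4 := (h1.trans (Reaches.single h2)).trans h3
    have h5 : fill u m j b = fill s m (j + 1) b := by
      funext e
      have := hue e
      unfold fill at *
      split_ifs at * <;> first | rfl | omega
    have h6 : 2 ^ (j - m) - 1 + 1 + (2 ^ (j - m) - 1) = 2 ^ (j + 1 - m) - 1 := by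
      have : 0 < 2 ^ (j - m) := by positivity
      rw [show j + 1 - m = j - m + 1 by omega, pow_succ]
      omega
    rwa [h5, h6] at h4

theorem exists_frameStewart_eq (m : ℕ) : ∃ k < m + 1,
    frameStewart (m + 1) = 2 * frameStewart k + (2 ^ (m + 1 - k) - 1) := by
  rw [frameStewart]
  obtain ⟨k, -, hk⟩ := Finset.exists_mem_eq_inf' (Finset.univ_nonempty (α := Fin (m + 1)))
    (fun k => 2 * frameStewart k.val + (2 ^ (m + 1 - k.val) - 1))
  exact ⟨k.val, k.isLt, hk⟩

theorem frameStewart_le {k m : ℕ} (h : k < m + 1) :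
    frameStewart (m + 1) ≤ 2 * frameStewart k + (2 ^ (m + 1 - k) - 1) := by
  rw [frameStewart]
  exact Finset.inf'_le (fun k : Fin (m + 1) => 2 * frameStewart k.val + (2 ^ (m + 1 - k.val) - 1))
    (Finset.mem_univ (⟨k, h⟩ : Fin (m + 1)))

theorem reaches_fill (s : Config 4 n) {m : ℕ} {a b : Fin 4} (hmn : m ≤ n) (hab : a ≠ b)
    (hs : ∀ e : Fin n, e.val < m → s e = a) : Reaches s (fill s 0 m b) (frameStewart m) := by
  induction m using Nat.strong_induction_on generalizing s a b with
  | _ m ih =>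
    rcases m with _ | m
    · have h : fill s 0 0 b = s := by
        funext e
        exact if_neg (by omega)
      rw [h, frameStewart]
      exact Reaches.refl s
    · obtain ⟨k, hk, hfs⟩ := exists_frameStewart_eq m
      obtain ⟨r, d, hra, hrb, hda, hdb, hrd⟩ : ∃ r d : Fin 4,
          r ≠ a ∧ r ≠ b ∧ d ≠ a ∧ d ≠ b ∧ d ≠ r := by
        clear ih hs hmn
        revert a b
        decide
      have h1 := ih k hk s (by omega) hra.symm fun e he => hs e (by omega)
      have h2 := reaches_fill_three (m := k) (j := m + 1) (a := a) (b := b) (d := d) (r := r)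
        (fill s 0 k r) (by omega) hmn hab hda.symm hra.symm hdb.symm hrb.symm hrd
        (fun e he => if_pos (by omega))
        (fun e he he' => by rw [fill, if_neg (by omega), hs e he'])
      have h3 := ih k hk (fill (fill s 0 k r) k (m + 1) b) (a := r) (b := b) (by omega) hrb
        (fun e he => by rw [fill, if_neg (by omega), fill, if_pos (by omega)])
      have h4 := (h1.trans h2).trans h3
      have h5 : fill (fill (fill s 0 k r) k (m + 1) b) 0 k b = fill s 0 (m + 1) b := by
        funext e
        unfold fill
        split_ifs <;> first | rfl | omega
      rw [h5] at h4
      convert h4 using 1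
      omega

theorem canTransfer_frameStewart {a b : Fin 4} (hab : a ≠ b) :
    CanTransfer 4 n a b (frameStewart n) := by
  have h := reaches_fill (tower 4 n a) le_rfl hab fun _ _ => rfl
  have h1 : fill (tower 4 n a) 0 n b = tower 4 n b := by
    funext e
    exact if_pos ⟨Nat.zero_le _, e.isLt⟩
  rwa [h1] at h

/-! ### Comparison of the two bounds -/

theorem frameStewart_le_sum (n : ℕ) :
    (frameStewart n : ℤ) ≤ ∑ k ∈ Finset.range n, (2 : ℤ) ^ triRoot k := by
  induction n using Nat.strong_induction_on with
  | _ n ih =>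
    rcases n with _ | m
    · simp [frameStewart]
    · obtain ⟨p, r, hr, hp⟩ := exists_eq_tri_add (m + 1)
      obtain ⟨q, rfl⟩ : ∃ q, p = q + 1 := by
        rcases p with _ | q
        · rw [tri_zero] at hp
          omega
        · exact ⟨q, rfl⟩
      have ht := tri_succ q
      -- Keeping the offset `r` and lowering the triangular index by one leaves `q + 1` disks for
      -- three pegs; the closed form satisfies the recursion with equality at this choice.
      have h1 := frameStewart_le (k := tri q + r) (m := m) (by omega)
      have h2 := ih (tri q + r) (by omega)
      rw [sum_two_pow_triRoot q r hr] at h2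
      rw [hp, sum_two_pow_triRoot (q + 1) r (by omega), ← hp]
      have h3 : m + 1 - (tri q + r) = q + 1 := by omega
      rw [h3] at h1
      have h4 : (frameStewart (m + 1) : ℤ) ≤ 2 * frameStewart (tri q + r) + (2 ^ (q + 1) - 1) := by
        have : ((2 ^ (q + 1) - 1 : ℕ) : ℤ) = 2 ^ (q + 1) - 1 := by
          rw [Nat.cast_sub Nat.one_le_two_pow]
          push_cast
          rfl
        rw [← this]
        exact_mod_cast h1
      refine h4.trans ?_
      push_cast
      rw [pow_succ]
      linarith

theorem sum_le_of_canTransfer {l : ℕ} {a b : Fin 4} (hab : a ≠ b)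
    (h : CanTransfer 4 n a b l) : ∑ k ∈ Finset.range n, (2 : ℤ) ^ triRoot k ≤ l := by
  obtain ⟨c, h0, hl, hc⟩ := h
  -- The path is extended to infinitely many disks and all times: disks from `n` on never move, and
  -- nothing moves after time `l`.
  obtain ⟨c', hc'⟩ : ∃ c' : ℕ → ℕ → Fin 4, ∀ i k,
      c' i k = if h : k < n then c (min i l) ⟨k, h⟩ else a := ⟨_, fun _ _ => rfl⟩
  have hstep : ∀ i, (∀ k, c' (i + 1) k = c' i k) ∨ ∃ d, c' i d ≠ c' (i + 1) d ∧
      (∀ e < d, c' i e ≠ c' i d ∧ c' i e ≠ c' (i + 1) d) ∧ ∀ k ≠ d, c' (i + 1) k = c' i k := by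
    intro i
    rcases lt_or_ge i l with hi | hi
    · obtain ⟨d, p, hp, he, hd⟩ := hc i hi
      have hi1 : min i l = i := by omega
      have hi2 : min (i + 1) l = i + 1 := by omega
      have hcd : c' i d = c i d := by simp [hc', hi1]
      have hcd' : c' (i + 1) d = p := by simp [hc', hi2, hd]
      refine Or.inr ⟨d, ?_, fun e hed => ?_, fun k hk => ?_⟩
      · rw [hcd, hcd']
        exact hp.symm
      · rw [hcd, hcd', hc', dif_pos (hed.trans d.isLt), hi1]
        exact he ⟨e, _⟩ hed
      · rw [hc', hc', hi1, hi2]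
        split_ifs with h
        · rw [hd, Function.update_of_ne]
          exact fun h' => hk (by rw [← h'])
        · rfl
    · refine Or.inl fun k => ?_
      rw [hc', hc', show min (i + 1) l = min i l by omega]
  have hlegal : Legal c' := by
    intro i k hk j hj
    rcases hstep i with h | ⟨d, -, h2, h3⟩
    · exact absurd (h k) hk
    · obtain rfl : k = d := by
        by_contra hkd
        exact hk (h3 k hkd)
      exact ⟨h3 j hj.ne, h2 j hj⟩
  have hcost : cost c' (Finset.range n) 0 l ≤ l := by
    have h1 : ∀ i ∈ Finset.Ico 0 l,
        ((Finset.range n).filter (fun k => c' (i + 1) k ≠ c' i k)).card ≤ 1 := by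
      intro i _
      rcases hstep i with h | ⟨d, -, -, h3⟩
      · simp [h]
      · refine (Finset.card_le_card fun k hk => ?_).trans (Finset.card_singleton d).le
        rw [Finset.mem_singleton]
        by_contra hkd
        exact (Finset.mem_filter.1 hk).2 (h3 k hkd)
    simpa [cost] using Finset.sum_le_card_nsmul _ _ 1 h1
  refine (sum_two_pow_triRoot_le_cost hlegal hab (l := l) (fun k hk => ?_) fun k hk => ?_).trans
    (by exact_mod_cast hcost)
  · simp [hc', hk, h0, tower]
  · simp [hc', hk, hl, tower]

end Hanoi

theorem mainTheorem1 (n : ℕ) (a b : Fin 4) (hab : a ≠ b) :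
    IsLeast {l : ℕ | Hanoi.CanTransfer 4 n a b l} (Hanoi.frameStewart n) ∧
      Hanoi.frameStewart n = ∑ j ∈ Finset.Icc 1 n, 2 ^ (Hanoi.f4 j - 1) := by
  have h1 := Hanoi.canTransfer_frameStewart (n := n) hab
  have h2 := Hanoi.frameStewart_le_sum n
  refine ⟨⟨h1, fun l hl => ?_⟩, ?_⟩
  · exact_mod_cast h2.trans (Hanoi.sum_le_of_canTransfer hab hl)
  · have h3 := le_antisymm h2 (Hanoi.sum_le_of_canTransfer hab h1)
    have h4 : Hanoi.frameStewart n = ∑ k ∈ Finset.range n, 2 ^ Hanoi.triRoot k := by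
      exact_mod_cast h3
    rw [h4, Finset.range_eq_Ico]
    exact Finset.sum_Ico_add' (fun j => 2 ^ (Hanoi.f4 j - 1)) 0 n 1
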